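/- Let $k,n\ge 1$ and let $\mathbb{T}^n=\mathbb{R}^n/\mathbb{Z}^n$ with its usual metric. Let $A_1,\dots,A_k$ be pairwise different non-singular integer $n\times n$ matrices all of whose (complex) eigenvalues have modulus greater than $1$, and let $T:\mathbb{Z}_+^k\to C^0(\mathbb{T}^n,\mathbb{T}^n)$ be a $\mathbb{Z}_+^k$-action (so $T^0=\mathrm{id}$ and $T^{u+v}=T^u\circ T^v$; in particular the generators commute) whose $i$-th generator $T_i$ is the endomorphism $x\mapsto A_ix \pmod{\mathbb{Z}^n}$ of $\mathbb{T}^n$. Let $$X_T=\bigl\{(x_m)_{m\ge 0}\in(\mathbb{T}^n)^{\mathbb{Z}_+} : \text{for every } m\ge 0 \text{ there is } i\in\{1,\dots,k\} \text{ with } T_i(x_m)=x_{m+1}\bigr\}$$ with the metric $d(\bar x,\bar y)=\sum_{m\ge 0}2^{-m}d_{\mathbb{T}^n}(x_m,y_m)$, let $\sigma_T:X_T\to X_T$, $(x_m)_m\mapsto(x_{m+1})_m$, be the shift, and let $h(T)$ be the topological entropy of $\sigma_T$, that is, $$h(T)=\lim_{\varepsilon\to 0}\limsup_{N\to\infty}\frac1N\log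 r(\sigma_T,N,\varepsilon),$$ where $r(\sigma_T,N,\varepsilon)$ is the least cardinality of a set $E\subset X_T$ such that every $\bar x\in X_T$ has some $\bar y\in E$ with $d(\sigma_T^j\bar x,\sigma_T^j\bar y)\le\varepsilon$ for $0\le j\le N-1$. Then $$h(T)\le\log\Bigl(\sum_{i=1}^k\prod_{j=1}^n|\lambda_i^{(j)}|\Bigr)=\log\Bigl(\sum_{i=1}^k|\det A_i|\Bigr),$$ where $\lambda_i^{(1)},\dots,\lambda_i^{(n)}$ are the eigenvalues of $A_i$ counted with algebraic multiplicity. -/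

import Mathlib

noncomputable section

/-- A continuous `ℤ₊ᵏ`-action on `X`: a map `T : ℤ₊ᵏ → C⁰(X, X)` with `T 0 = id` and
`T (u + v) = T u ∘ T v`. In particular the maps `T u` commute pairwise. -/
structure ZPlusAction (k : ℕ) (X : Type*) [TopologicalSpace X] where
  /-- The map `Tᵘ` for `u ∈ ℤ₊ᵏ`. -/
  toFun : (Fin k → ℕ) → C(X, X)
  map_zero : toFun 0 = ContinuousMap.id X
  map_add : ∀ u v : Fin k → ℕ, toFun (u + v) = (toFun u).comp (toFun v)

/-- The generators `T_i = T(0, …, 0, 1, 0, …, 0)` (the `1` at place `i`) of an action. -/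
def ZPlusAction.generator {k : ℕ} {X : Type*} [TopologicalSpace X] (T : ZPlusAction k X)
    (i : Fin k) : C(X, X) :=
  T.toFun (Pi.single i 1)

/-- The orbit space `X_T`: all sequences `(x_m)` in `X` such that for every `m` some generator
`T_i` maps `x_m` to `x_{m+1}`. -/
@[ext]
structure OrbitSpace {k : ℕ} {X : Type*} [TopologicalSpace X] (T : ZPlusAction k X) where
  /-- The underlying sequence of points of `X`. -/
  seq : ℕ → X
  step : ∀ m : ℕ, ∃ i : Fin k, T.generator i (seq m) = seq (m + 1)

namespace OrbitSpace

/-- The shift `σ_T : X_T → X_T`, `(x_m)_m ↦ (x_{m+1})_m`. -/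
def shift {k : ℕ} {X : Type*} [TopologicalSpace X] (T : ZPlusAction k X) :
    OrbitSpace T → OrbitSpace T :=
  fun x => ⟨fun m => x.seq (m + 1), fun m => x.step (m + 1)⟩

theorem summable_dist {X : Type*} [MetricSpace X] [CompactSpace X] (x y : ℕ → X) :
    Summable fun m : ℕ => dist (x m) (y m) / 2 ^ m := by
  refine Summable.of_nonneg_of_le (fun m => by positivity) (fun m => ?_)
    (summable_geometric_two.mul_left (Metric.diam (Set.univ : Set X)))
  have h : dist (x m) (y m) ≤ Metric.diam (Set.univ : Set X) :=
    Metric.dist_le_diam_of_mem isCompact_univ.isBounded (Set.mem_univ _) (Set.mem_univ _)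
  rw [div_eq_mul_one_div, one_div_pow]
  exact mul_le_mul_of_nonneg_right h (by positivity)

/-- The metric `d(x, y) = ∑ₘ d_X(x_m, y_m) / 2 ^ m` on the orbit space. -/
instance {k : ℕ} {X : Type*} [MetricSpace X] [CompactSpace X] (T : ZPlusAction k X) :
    MetricSpace (OrbitSpace T) where
  dist x y := ∑' m : ℕ, dist (x.seq m) (y.seq m) / 2 ^ m
  dist_self x := by simp
  dist_comm x y := by simp only [dist_comm]
  dist_triangle x y z := by
    rw [← (summable_dist x.seq y.seq).tsum_add (summable_dist y.seq z.seq)]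
    refine (summable_dist x.seq z.seq).tsum_le_tsum (fun m => ?_)
      ((summable_dist x.seq y.seq).add (summable_dist y.seq z.seq))
    rw [← add_div]
    exact div_le_div_of_nonneg_right (dist_triangle _ _ _) (by positivity)
  eq_of_dist_eq_zero := by
    intro x y h
    have h0 := (hasSum_zero_iff_of_nonneg
      (fun m => div_nonneg dist_nonneg (by positivity))).1
      (h ▸ (summable_dist x.seq y.seq).hasSum)
    ext m
    have hm := congrFun h0 m
    simpa using hm

end OrbitSpace

/-- Friedland's topological entropy `h(T)` of a `ℤ₊ᵏ`-action: the (Bowen) topological entropy of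
the shift `σ_T` on the orbit space `X_T`. It is the supremum over entourages (equivalently the
limit as `ε → 0`) of the exponential growth rate `limsup (1/n) log r(σ_T, n, ε)` of the minimal
cardinality of `(σ_T, n, ε)`-spanning sets of `X_T`. -/
def friedlandEntropy {k : ℕ} {X : Type*} [MetricSpace X] [CompactSpace X]
    (T : ZPlusAction k X) : EReal :=
  Dynamics.coverEntropy (OrbitSpace.shift T) Set.univ

/-- The endomorphism of `𝕋ⁿ = ℝⁿ/ℤⁿ` induced by an integer matrix `A`: `x ↦ A x mod ℤⁿ`. -/
def torusEndomorphism {n : ℕ} (A : Matrix (Fin n) (Fin n) ℤ) :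
    UnitAddTorus (Fin n) → UnitAddTorus (Fin n) :=
  fun x i => ∑ j, A i j • x j

/-- The complex eigenvalues of an integer matrix, counted with algebraic multiplicity. -/
def complexEigenvalues {n : ℕ} (A : Matrix (Fin n) (Fin n) ℤ) : Multiset ℂ :=
  (A.map (Int.cast : ℤ → ℂ)).charpoly.roots

end

open Filter Topology Matrix

/-! An orbit is a word `s` in the generators together with a lift `p` of its starting point to `ℝⁿ`.
The `Aᵢ` commute because the generators do, and each `Aᵢ⁻¹` has spectral radius below `1`, so the
inverses of all products of the `Aᵢ` are bounded by one constant `C`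
(`exists_norm_inv_le_of_mem_closure`). Hence two lifts that are close at time `M` along a common
word were close at all earlier times, up to the factor `C`.

So only the endpoint `B p` matters, where `B` is the product along the word, and `p` counts only
modulo `ℤⁿ`, so `B p` counts only modulo `B ℤⁿ`. A grid of mesh `1 / K` on `ℝⁿ / B ℤⁿ` has `Kⁿ |det
B|` points (`exists_shadow`). Summing over words of length `M` gives `Kⁿ (∑ᵢ |det Aᵢ|) ^ M`
shadowing orbits (`exists_shadowing_finset`), whose growth rate is the bound. -/

/-! ### Uniform bounds for inverses of products -/

/-- Commutativity lets all powers of one generator be collected in front, so the bound grows by one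
factor per generator, whatever the length of the product. -/
theorem exists_norm_le_of_mem_closure_range {R ι : Type*} [NormedRing R] [Fintype ι] (a : ι → R)
    (hcomm : ∀ i j, Commute (a i) (a j)) (hb : ∀ i, ∃ C : ℝ, ∀ m : ℕ, ‖a i ^ m‖ ≤ C) :
    ∃ C : ℝ, ∀ x ∈ Submonoid.closure (Set.range a), ‖x‖ ≤ C := by
  classical
  suffices h : ∀ S : Finset ι, ∃ C : ℝ, ∀ x ∈ Submonoid.closure (a '' S), ‖x‖ ≤ C by
    simpa using h Finset.univ
  intro S
  induction S using Finset.induction_on with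
  | empty => exact ⟨‖(1 : R)‖, by simp⟩
  | insert i S _ ih =>
    obtain ⟨C, hC⟩ := ih
    obtain ⟨D, hD⟩ := hb i
    have hcl : ∀ y ∈ Submonoid.closure (a '' S), Commute y (a i) := by
      intro y hy
      induction hy using Submonoid.closure_induction with
      | mem y hy =>
        obtain ⟨j, -, rfl⟩ := hy
        exact hcomm j i
      | one => exact Commute.one_left _
      | mul y z _ _ hy hz => exact hy.mul_left hz
    have key : ∀ x ∈ Submonoid.closure (a '' (insert i S : Finset ι)),
        ∃ m : ℕ, ∃ y ∈ Submonoid.closure (a '' S), x = a i ^ m * y := by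
      intro x hx
      induction hx using Submonoid.closure_induction with
      | mem x hx =>
        obtain ⟨j, hj, rfl⟩ := hx
        rcases Finset.mem_insert.1 (Finset.mem_coe.1 hj) with rfl | hj
        · exact ⟨1, 1, one_mem _, by simp⟩
        · exact ⟨0, a j, Submonoid.subset_closure ⟨j, hj, rfl⟩, by simp⟩
      | one => exact ⟨0, 1, one_mem _, by simp⟩
      | mul x z _ _ hx hz =>
        obtain ⟨p, y, hy, rfl⟩ := hx
        obtain ⟨q, w, hw, rfl⟩ := hz
        refine ⟨p + q, y * w, mul_mem hy hw, ?_⟩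
        rw [pow_add, mul_assoc, mul_assoc, ← mul_assoc y, ((hcl y hy).pow_right q).eq, mul_assoc]
    refine ⟨D * C, fun x hx => ?_⟩
    obtain ⟨m, y, hy, rfl⟩ := key x hx
    exact (norm_mul_le _ _).trans (mul_le_mul (hD m) (hC y hy) (norm_nonneg _)
      ((norm_nonneg _).trans (hD 0)))

/-- Gelfand's formula gives `‖a ^ m‖ < 1` for all large `m`; the finitely many other powers are
absorbed in a sum. -/
theorem exists_norm_pow_le_of_spectralRadius_lt_one {R : Type*} [NormedRing R] [NormedAlgebra ℂ R]
    [CompleteSpace R] (a : R) (ha : spectralRadius ℂ a < 1) :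
    ∃ C : ℝ, ∀ m : ℕ, ‖a ^ m‖ ≤ C := by
  have h := (spectrum.pow_nnnorm_pow_one_div_tendsto_nhds_spectralRadius a).eventually_lt_const ha
  obtain ⟨N, hN⟩ := eventually_atTop.1 (h.and (eventually_gt_atTop 0))
  refine ⟨1 + ∑ m ∈ Finset.range N, ‖a ^ m‖, fun m => ?_⟩
  by_cases hm : m < N
  · have := Finset.single_le_sum (f := fun m => ‖a ^ m‖) (fun _ _ => norm_nonneg _)
      (Finset.mem_range.2 hm)
    linarith
  · obtain ⟨h1, h0⟩ := hN m (not_lt.1 hm)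
    have h2 : (‖a ^ m‖₊ : ENNReal) < 1 := by
      by_contra hge
      exact absurd h1 (not_lt.2 (ENNReal.one_le_rpow (not_lt.1 hge) (by positivity)))
    have h3 : ‖a ^ m‖ < 1 := by exact_mod_cast h2
    have : 0 ≤ ∑ m ∈ Finset.range N, ‖a ^ m‖ := Finset.sum_nonneg fun _ _ => norm_nonneg _
    linarith

section LinftyOpNorm

attribute [local instance] Matrix.linftyOpNormedAddCommGroup Matrix.linftyOpNormedRing
  Matrix.linftyOpNormedAlgebra

theorem Matrix.exists_norm_inv_pow_le {n : ℕ} (A : Matrix (Fin n) (Fin n) ℂ)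
    (hexp : ∀ μ ∈ A.charpoly.roots, 1 < ‖μ‖) (hA : A.det ≠ 0) :
    ∃ C : ℝ, ∀ m : ℕ, ‖A⁻¹ ^ m‖ ≤ C := by
  -- The spectral radius argument needs a nontrivial ring, so `n = 0` is separate.
  rcases isEmpty_or_nonempty (Fin n) with hn | hn
  · exact ⟨0, fun m => by rw [Subsingleton.elim (A⁻¹ ^ m) 0, norm_zero]⟩
  have : Nontrivial (Matrix (Fin n) (Fin n) ℂ) := inferInstance
  refine exists_norm_pow_le_of_spectralRadius_lt_one _ ?_
  refine spectrum.spectralRadius_lt_of_forall_lt (r := 1) _ fun z hz => ?_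
  have hu : IsUnit A := A.isUnit_iff_isUnit_det.2 (isUnit_iff_ne_zero.2 hA)
  obtain ⟨u, rfl⟩ := hu
  rw [← Matrix.coe_units_inv] at hz
  have hz0 : z ≠ 0 := spectrum.ne_zero_of_mem_of_unit hz
  have hz' := (spectrum.inv₀_mem_iff (R := ℂ) (r := z) (a := u)).2 hz
  rw [Matrix.mem_spectrum_iff_isRoot_charpoly] at hz'
  have := hexp _ ((Polynomial.mem_roots (Matrix.charpoly_monic _).ne_zero).2 hz')
  rw [norm_inv, one_lt_inv_iff₀] at this
  exact_mod_cast this.2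

/-- Brings the bound, obtained over `ℂ` by spectral theory, back to real matrices. -/
theorem Matrix.linfty_opNorm_map_ofReal {n : ℕ} (M : Matrix (Fin n) (Fin n) ℝ) :
    ‖M.map ((↑) : ℝ → ℂ)‖ = ‖M‖ := by
  simp [Matrix.linfty_opNorm_def]

/-- The ring homomorphism viewing an integer matrix as a real matrix. -/
abbrev realMatrix {n : ℕ} : Matrix (Fin n) (Fin n) ℤ →+* Matrix (Fin n) (Fin n) ℝ :=
  (Int.castRingHom ℝ).mapMatrix

/-- Inverses of products of commuting expanding integer matrices are uniformly bounded. -/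
theorem exists_norm_inv_le_of_mem_closure {k n : ℕ} (A : Fin k → Matrix (Fin n) (Fin n) ℤ)
    (hcomm : ∀ i j, A i * A j = A j * A i) (hns : ∀ i, (A i).det ≠ 0)
    (hexp : ∀ i, ∀ μ ∈ complexEigenvalues (A i), 1 < ‖μ‖) :
    ∃ C : ℝ, 0 ≤ C ∧ ∀ B ∈ Submonoid.closure (Set.range A), ∀ v : Fin n → ℝ,
      ‖v‖ ≤ C * ‖realMatrix B *ᵥ v‖ := by
  let φ : Matrix (Fin n) (Fin n) ℤ →+* Matrix (Fin n) (Fin n) ℝ := realMatrix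
  have hdet : ∀ i, (φ (A i)).det ≠ 0 := fun i => by
    rw [← RingHom.map_det]
    simpa using hns i
  have hc : ∀ i j, Commute (φ (A i))⁻¹ (φ (A j))⁻¹ := fun i j => by
    rw [commute_iff_eq, ← Matrix.mul_inv_rev, ← Matrix.mul_inv_rev, ← map_mul, ← map_mul, hcomm]
  have hb : ∀ i, ∃ C : ℝ, ∀ m : ℕ, ‖(φ (A i))⁻¹ ^ m‖ ≤ C := fun i => by
    let ψ : Matrix (Fin n) (Fin n) ℝ →+* Matrix (Fin n) (Fin n) ℂ := Complex.ofRealHom.mapMatrix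
    have hψ : (A i).map (Int.cast : ℤ → ℂ) = ψ (φ (A i)) := by
      ext; simp [ψ, φ, realMatrix]
    have hu : IsUnit (φ (A i)).det := isUnit_iff_ne_zero.2 (hdet i)
    have hinv : ψ (φ (A i))⁻¹ = (ψ (φ (A i)))⁻¹ := by
      refine (Matrix.inv_eq_right_inv ?_).symm
      rw [← map_mul, Matrix.mul_nonsing_inv _ hu, map_one]
    obtain ⟨C, hC⟩ := Matrix.exists_norm_inv_pow_le (ψ (φ (A i)))
      (fun μ hμ => hexp i μ (by rwa [complexEigenvalues, hψ]))
      (by rw [← RingHom.map_det]; simpa using hdet i)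
    refine ⟨C, fun m => ?_⟩
    have := hC m
    rw [← hinv, ← map_pow] at this
    rwa [← Matrix.linfty_opNorm_map_ofReal]
  obtain ⟨C, hC⟩ := exists_norm_le_of_mem_closure_range _ hc hb
  refine ⟨C, (norm_nonneg _).trans (hC 1 (one_mem _)), fun B hB v => ?_⟩
  have hB' : IsUnit (φ B).det ∧ (φ B)⁻¹ ∈ Submonoid.closure (Set.range fun i => (φ (A i))⁻¹) := by
    induction hB using Submonoid.closure_induction with
    | mem x hx =>
      obtain ⟨i, rfl⟩ := hx
      exact ⟨isUnit_iff_ne_zero.2 (hdet i), Submonoid.subset_closure ⟨i, rfl⟩⟩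
    | one => simp
    | mul x y _ _ hx hy =>
      rw [map_mul, Matrix.mul_inv_rev, Matrix.det_mul]
      exact ⟨hx.1.mul hy.1, mul_mem hy.2 hx.2⟩
  calc ‖v‖ = ‖(φ B)⁻¹ *ᵥ (φ B *ᵥ v)‖ := by
        rw [Matrix.mulVec_mulVec, Matrix.nonsing_inv_mul _ hB'.1, Matrix.one_mulVec]
    _ ≤ ‖(φ B)⁻¹‖ * ‖φ B *ᵥ v‖ := Matrix.linfty_opNorm_mulVec _ _
    _ ≤ C * ‖realMatrix B *ᵥ v‖ :=
        mul_le_mul_of_nonneg_right (hC _ hB'.2) (norm_nonneg _)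

end LinftyOpNorm

/-! ### Determinants as lattice indices and eigenvalue products -/

/-- The sublattice `B ℤⁿ` has at most `|det B|` cosets. -/
theorem Matrix.exists_finset_card_eq_natAbs_det {n : ℕ} (B : Matrix (Fin n) (Fin n) ℤ)
    (hB : B.det ≠ 0) : ∃ R : Finset (Fin n → ℤ), R.card = B.det.natAbs ∧
      ∀ z : Fin n → ℤ, ∃ q : Fin n → ℤ, ∃ r ∈ R, z = B *ᵥ q + r := by
  classical
  let f := Matrix.toLin' B
  have hf : Function.Injective f := by
    rw [← LinearMap.ker_eq_bot, Matrix.ker_toLin'_eq_bot_iff]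
    intro v hv
    exact Matrix.eq_zero_of_mulVec_eq_zero hB hv
  let e := LinearEquiv.ofInjective f hf
  have hcard : B.det.natAbs = Nat.card ((Fin n → ℤ) ⧸ LinearMap.range f) := by
    rw [← Submodule.natAbs_det_equiv (LinearMap.range f) e]
    have : (LinearMap.range f).subtype ∘ₗ (e : (Fin n → ℤ) →ₗ[ℤ] LinearMap.range f) = f := by
      ext; rfl
    change _ = (LinearMap.det ((LinearMap.range f).subtype ∘ₗ
      (e : (Fin n → ℤ) →ₗ[ℤ] LinearMap.range f))).natAbs
    rw [this, LinearMap.det_toLin']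
  -- `Nat.card` is `0` on infinite types, so a nonzero determinant forces a finite quotient.
  have hfin : Finite ((Fin n → ℤ) ⧸ LinearMap.range f) :=
    Nat.finite_of_card_ne_zero (by rw [← hcard]; simpa using hB)
  have := Fintype.ofFinite ((Fin n → ℤ) ⧸ LinearMap.range f)
  have hsurj := Submodule.mkQ_surjective (LinearMap.range f)
  refine ⟨Finset.univ.image (Function.surjInv hsurj), ?_, fun z => ?_⟩
  · rw [Finset.card_image_of_injective _ (Function.injective_surjInv hsurj), Finset.card_univ,
      hcard, Nat.card_eq_fintype_card]
  · have h : z - Function.surjInv hsurj ((LinearMap.range f).mkQ z) ∈ LinearMap.range f := by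
      rw [← Submodule.Quotient.eq]
      exact (Function.surjInv_eq hsurj _).symm
    obtain ⟨q, hq⟩ := h
    refine ⟨q, _, Finset.mem_image_of_mem _ (Finset.mem_univ ((LinearMap.range f).mkQ z)), ?_⟩
    rw [← Matrix.toLin'_apply]
    exact sub_eq_iff_eq_add.1 hq.symm

theorem prod_norm_complexEigenvalues {n : ℕ} (A : Matrix (Fin n) (Fin n) ℤ) :
    ((complexEigenvalues A).map fun μ => ‖μ‖).prod = |(A.det : ℝ)| := by
  have h := Matrix.det_eq_prod_roots_charpoly (A.map (Int.cast : ℤ → ℂ))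
  have h2 : (A.map (Int.cast : ℤ → ℂ)).det = (A.det : ℂ) :=
    ((Int.castRingHom ℂ).map_det A).symm
  have h3 := congrArg (fun z : ℂ => ‖z‖) (h.symm.trans h2)
  simp only [Complex.norm_intCast] at h3
  rw [← h3]
  exact (map_multiset_prod (normHom : ℂ →*₀ ℝ) _).symm

/-! ### Lifting torus endomorphisms to `ℝⁿ` -/

section TorusProj

variable {n : ℕ}

/-- The quotient map `ℝⁿ → 𝕋ⁿ`. -/
def torusProj (p : Fin n → ℝ) : UnitAddTorus (Fin n) := fun i => (p i : UnitAddCircle)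

theorem torusProj_surjective : Function.Surjective (torusProj (n := n)) := fun x => by
  choose p hp using fun i => QuotientAddGroup.mk_surjective (x i)
  exact ⟨p, funext hp⟩

theorem UnitAddCircle.coe_sum {ι : Type*} (s : Finset ι) (f : ι → ℝ) :
    ((∑ i ∈ s, f i : ℝ) : UnitAddCircle) = ∑ i ∈ s, (f i : UnitAddCircle) :=
  map_sum (QuotientAddGroup.mk' (AddSubgroup.zmultiples (1 : ℝ))) f s

theorem torusEndomorphism_torusProj (B : Matrix (Fin n) (Fin n) ℤ) (p : Fin n → ℝ) :
    torusEndomorphism B (torusProj p) = torusProj (realMatrix B *ᵥ p) := by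
  funext i
  simp only [torusEndomorphism, torusProj, Matrix.mulVec, dotProduct, UnitAddCircle.coe_sum]
  refine Finset.sum_congr rfl fun j _ => ?_
  rw [← AddCircle.coe_zsmul]
  simp [realMatrix]

theorem torusProj_add_intCast (p : Fin n → ℝ) (q : Fin n → ℤ) :
    torusProj (p + fun i => (q i : ℝ)) = torusProj p := by
  funext i
  simp [torusProj]

theorem dist_torusProj_le (p q : Fin n → ℝ) : dist (torusProj p) (torusProj q) ≤ ‖p - q‖ := by
  refine (dist_pi_le_iff (norm_nonneg _)).2 fun i => ?_
  rw [dist_eq_norm]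
  calc ‖(p i : UnitAddCircle) - (q i : UnitAddCircle)‖ = ‖((p i - q i : ℝ) : UnitAddCircle)‖ := by
        rw [AddCircle.coe_sub]
    _ ≤ ‖p i - q i‖ := QuotientAddGroup.norm_mk_le_norm
    _ ≤ ‖p - q‖ := norm_le_pi_norm (p - q) i

theorem torusEndomorphism_comp (B D : Matrix (Fin n) (Fin n) ℤ) :
    torusEndomorphism B ∘ torusEndomorphism D = torusEndomorphism (B * D) := by
  funext x
  obtain ⟨p, rfl⟩ := torusProj_surjective x
  simp only [Function.comp_apply, torusEndomorphism_torusProj, map_mul, Matrix.mulVec_mulVec]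

/-- Needed to pass from commuting generators to commuting matrices. If the `(i, j)` entries differ
by `d ≠ 0`, the point with `j`-th coordinate `1 / (2d)` and zeros elsewhere has images whose `i`-th
coordinates differ by `1 / 2`, which is not an integer. -/
theorem torusEndomorphism_injective : Function.Injective (torusEndomorphism (n := n)) := by
  intro B D h
  ext i j
  by_contra hne
  have hd : ((B i j : ℝ) - D i j) ≠ 0 := sub_ne_zero.2 (by exact_mod_cast hne)
  have h1 := congrFun (congrFun h (torusProj (Pi.single j (2 * ((B i j : ℝ) - D i j))⁻¹))) i
  rw [torusEndomorphism_torusProj, torusEndomorphism_torusProj, ← sub_eq_zero] at h1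
  simp only [torusProj, Matrix.mulVec_single] at h1
  rw [← AddCircle.coe_sub, AddCircle.coe_eq_zero_iff] at h1
  obtain ⟨m, hm⟩ := h1
  have h2 : (m : ℝ) = 1 / 2 := by
    simp [realMatrix] at hm
    rw [hm]
    field_simp
  have h3 : (2 * m : ℝ) = 1 := by rw [h2]; norm_num
  have h4 : 2 * m = 1 := by exact_mod_cast h3
  omega

theorem exists_int_add_grid {K : ℕ} (hK : 0 < K) (y : Fin n → ℝ) :
    ∃ (z : Fin n → ℤ) (g : Fin n → Fin K),
      ‖y - ((fun i => (z i : ℝ)) + fun i => ((g i : ℕ) : ℝ) / K)‖ ≤ 1 / K := by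
  have hK' : (0 : ℝ) < K := by exact_mod_cast hK
  have hg : ∀ i, ⌊K * Int.fract (y i)⌋₊ < K := fun i => by
    rw [Nat.floor_lt (by positivity)]
    exact mul_lt_of_lt_one_right hK' (Int.fract_lt_one _)
  refine ⟨fun i => ⌊y i⌋, fun i => ⟨_, hg i⟩, (pi_norm_le_iff_of_nonneg (by positivity)).2 fun i => ?_⟩
  have h1 := Nat.floor_le (a := K * Int.fract (y i)) (by positivity)
  have h2 := Nat.lt_floor_add_one (K * Int.fract (y i))
  have h3 : y i - (⌊y i⌋ + (⌊K * Int.fract (y i)⌋₊ : ℝ) / K) =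
      (K * Int.fract (y i) - ⌊K * Int.fract (y i)⌋₊) / K := by
    rw [Int.fract]
    field_simp
    ring
  simp only [Pi.sub_apply, Pi.add_apply]
  rw [h3, Real.norm_eq_abs, abs_of_nonneg (div_nonneg (by linarith) hK'.le)]
  gcongr
  linarith

end TorusProj

/-! ### Products along words and shadowing -/

section WordMatrix

variable {k n : ℕ} (A : Fin k → Matrix (Fin n) (Fin n) ℤ)

/-- The matrix `A_{s (m-1)} ⋯ A_{s 1} A_{s 0}` of the first `m` letters of `s`. -/
def wordMatrix (s : ℕ → Fin k) : ℕ → Matrix (Fin n) (Fin n) ℤ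
  | 0 => 1
  | m + 1 => A (s m) * wordMatrix s m

theorem wordMatrix_mem_closure (s : ℕ → Fin k) (m : ℕ) :
    wordMatrix A s m ∈ Submonoid.closure (Set.range A) := by
  induction m with
  | zero => exact one_mem _
  | succ m ih => exact mul_mem (Submonoid.subset_closure ⟨_, rfl⟩) ih

theorem wordMatrix_add (s : ℕ → Fin k) (m l : ℕ) :
    wordMatrix A s (m + l) = wordMatrix A (fun j => s (m + j)) l * wordMatrix A s m := by
  induction l with
  | zero => simp [wordMatrix]
  | succ l ih => rw [← add_assoc, wordMatrix, ih, wordMatrix, mul_assoc]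

theorem wordMatrix_congr {s t : ℕ → Fin k} {m : ℕ} (h : ∀ j < m, s j = t j) :
    wordMatrix A s m = wordMatrix A t m := by
  induction m with
  | zero => rfl
  | succ m ih =>
    rw [wordMatrix, wordMatrix, h m (by omega), ih fun j hj => h j (by omega)]

theorem natAbs_det_wordMatrix (s : ℕ → Fin k) (m : ℕ) :
    (wordMatrix A s m).det.natAbs = ∏ j ∈ Finset.range m, (A (s j)).det.natAbs := by
  induction m with
  | zero => simp [wordMatrix]
  | succ m ih => rw [wordMatrix, Matrix.det_mul, Int.natAbs_mul, ih, Finset.prod_range_succ, mul_comm]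

/-- A lift `p` of a point is shadowed, along the word `s` of length `M`, by a preimage under the
word matrix of a grid point translated by a coset representative. -/
theorem exists_shadow {C : ℝ} (hC0 : 0 ≤ C)
    (hC : ∀ B ∈ Submonoid.closure (Set.range A), ∀ v : Fin n → ℝ, ‖v‖ ≤ C * ‖realMatrix B *ᵥ v‖)
    (s : ℕ → Fin k) (M : ℕ) (hdet : (wordMatrix A s M).det ≠ 0) {R : Finset (Fin n → ℤ)}
    (hR : ∀ z : Fin n → ℤ, ∃ q : Fin n → ℤ, ∃ r ∈ R, z = wordMatrix A s M *ᵥ q + r)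
    {K : ℕ} (hK : 0 < K) (p : Fin n → ℝ) :
    ∃ r ∈ R, ∃ g : Fin n → Fin K, ∀ m ≤ M,
      dist (torusProj (realMatrix (wordMatrix A s m) *ᵥ p))
        (torusProj (realMatrix (wordMatrix A s m) *ᵥ ((realMatrix (wordMatrix A s M))⁻¹ *ᵥ
          ((fun i => (r i : ℝ)) + fun i => ((g i : ℕ) : ℝ) / K)))) ≤ C * (1 / K) := by
  obtain ⟨z, g, hzg⟩ := exists_int_add_grid hK (realMatrix (wordMatrix A s M) *ᵥ p)
  obtain ⟨q, r, hr, rfl⟩ := hR z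
  refine ⟨r, hr, g, fun m hm => ?_⟩
  have hcast : ∀ (B : Matrix (Fin n) (Fin n) ℤ) (v : Fin n → ℤ),
      realMatrix B *ᵥ (fun i => (v i : ℝ)) = fun i => ((B *ᵥ v) i : ℝ) := fun B v => by
    funext i
    simp [Matrix.mulVec, dotProduct, realMatrix]
  set y := (realMatrix (wordMatrix A s M))⁻¹ *ᵥ
          ((fun i => (r i : ℝ)) + fun i => ((g i : ℕ) : ℝ) / K) with hy
  have hu : IsUnit (realMatrix (wordMatrix A s M)).det := by
    rw [← RingHom.map_det]
    simpa using hdet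
  -- The error vector, after translating `p` by the integer vector `q`, which is invisible on the
  -- torus.
  set u := p - (fun i => (q i : ℝ)) - y with hu_def
  have hMu : ‖realMatrix (wordMatrix A s M) *ᵥ u‖ ≤ 1 / K := by
    refine le_of_eq_of_le (congrArg _ ?_) hzg
    rw [hu_def, Matrix.mulVec_sub, Matrix.mulVec_sub, hy, Matrix.mulVec_mulVec,
      Matrix.mul_nonsing_inv _ hu, Matrix.one_mulVec, hcast]
    funext i
    simp
    ring
  -- Pull the error back from time `M` to time `m`: the remaining letters form a product whose
  -- inverse is bounded by `C`.
  have hmu : ‖realMatrix (wordMatrix A s m) *ᵥ u‖ ≤ C * (1 / K) := by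
    obtain ⟨l, rfl⟩ := Nat.exists_eq_add_of_le hm
    refine (hC _ (wordMatrix_mem_closure A (fun j => s (m + j)) l) _).trans ?_
    rw [Matrix.mulVec_mulVec, ← map_mul, ← wordMatrix_add]
    exact mul_le_mul_of_nonneg_left hMu hC0
  have hp : realMatrix (wordMatrix A s m) *ᵥ p = (realMatrix (wordMatrix A s m) *ᵥ y +
      realMatrix (wordMatrix A s m) *ᵥ u) + fun i => ((wordMatrix A s m *ᵥ q) i : ℝ) := by
    rw [← hcast, ← Matrix.mulVec_add, ← Matrix.mulVec_add, hu_def]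
    congr 1
    abel
  rw [hp, torusProj_add_intCast]
  refine (dist_torusProj_le _ _).trans ?_
  rwa [add_sub_cancel_left]

end WordMatrix

/-! ### Geometry of the orbit space -/

namespace OrbitSpace

theorem seq_iterate_shift {k : ℕ} {X : Type*} [TopologicalSpace X] (T : ZPlusAction k X)
    (x : OrbitSpace T) (j m : ℕ) : ((shift T)^[j] x).seq m = x.seq (j + m) := by
  induction j generalizing x with
  | zero => simp
  | succ j ih =>
    rw [Function.iterate_succ_apply, ih]
    exact congrArg x.seq (by omega)

theorem dist_def {k : ℕ} {X : Type*} [MetricSpace X] [CompactSpace X] {T : ZPlusAction k X}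
    (x y : OrbitSpace T) : dist x y = ∑' m : ℕ, dist (x.seq m) (y.seq m) / 2 ^ m := rfl

/-- The first `L` terms are compared with a geometric series of ratio `1 / 2`; the tail is bounded
by the diameter. -/
theorem dist_le_of_forall_lt {k : ℕ} {X : Type*} [MetricSpace X] [CompactSpace X]
    {T : ZPlusAction k X} {x y : OrbitSpace T} {δ : ℝ} {L : ℕ}
    (h : ∀ m < L, dist (x.seq m) (y.seq m) ≤ δ) (hδ : 0 ≤ δ) :
    dist x y ≤ 2 * δ + 2 * Metric.diam (Set.univ : Set X) / 2 ^ L := by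
  have hs := summable_dist x.seq y.seq
  rw [dist_def, ← hs.sum_add_tsum_nat_add L]
  refine add_le_add ?_ ?_
  · calc ∑ m ∈ Finset.range L, dist (x.seq m) (y.seq m) / 2 ^ m
        ≤ ∑ m ∈ Finset.range L, δ * (1 / 2) ^ m := by
          refine Finset.sum_le_sum fun m hm => ?_
          rw [_root_.one_div_pow, mul_one_div]
          exact div_le_div_of_nonneg_right (h m (Finset.mem_range.1 hm)) (by positivity)
      _ ≤ ∑' m : ℕ, δ * (1 / 2) ^ m :=
          (summable_geometric_two.mul_left δ).sum_le_tsum _ fun m _ => by positivity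
      _ = 2 * δ := by rw [tsum_mul_left, tsum_geometric_two, mul_comm]
  · have hD : Summable fun m : ℕ => Metric.diam (Set.univ : Set X) / 2 ^ L * (1 / 2) ^ m :=
      summable_geometric_two.mul_left _
    calc ∑' m : ℕ, dist (x.seq (m + L)) (y.seq (m + L)) / 2 ^ (m + L)
        ≤ ∑' m : ℕ, Metric.diam (Set.univ : Set X) / 2 ^ L * (1 / 2) ^ m := by
          refine ((summable_nat_add_iff L).2 hs).tsum_le_tsum (fun m => ?_) hD
          rw [_root_.one_div_pow, mul_one_div, div_div, pow_add, mul_comm ((2 : ℝ) ^ m)]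
          exact div_le_div_of_nonneg_right (Metric.dist_le_diam_of_mem isCompact_univ.isBounded
            (Set.mem_univ _) (Set.mem_univ _)) (by positivity)
      _ = 2 * Metric.diam (Set.univ : Set X) / 2 ^ L := by
          rw [tsum_mul_left, tsum_geometric_two]
          ring

section Linear

variable {k n : ℕ} {A : Fin k → Matrix (Fin n) (Fin n) ℤ}
  {T : ZPlusAction k (UnitAddTorus (Fin n))}

/-- The orbit of the image of `p` in the torus along the word `s`. -/
def ofWord (hT : ∀ i : Fin k, ⇑(T.generator i) = torusEndomorphism (A i)) (s : ℕ → Fin k)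
    (p : Fin n → ℝ) : OrbitSpace T where
  seq m := torusProj (realMatrix (wordMatrix A s m) *ᵥ p)
  step m := ⟨s m, by
    rw [hT, torusEndomorphism_torusProj, Matrix.mulVec_mulVec, ← map_mul, wordMatrix]⟩

theorem exists_eq_ofWord (hT : ∀ i : Fin k, ⇑(T.generator i) = torusEndomorphism (A i))
    (x : OrbitSpace T) : ∃ s p, x = ofWord hT s p := by
  choose s hs using x.step
  obtain ⟨p, hp⟩ := torusProj_surjective (x.seq 0)
  refine ⟨s, p, ?_⟩
  ext1
  funext m
  induction m with
  | zero => simp [ofWord, wordMatrix, hp]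
  | succ m ih =>
    rw [← hs m, ih, hT]
    simp only [ofWord]
    rw [torusEndomorphism_torusProj, Matrix.mulVec_mulVec, ← map_mul, wordMatrix]

end Linear

end OrbitSpace

theorem ZPlusAction.generator_comp_comm {k : ℕ} {X : Type*} [TopologicalSpace X]
    (T : ZPlusAction k X) (i j : Fin k) :
    ⇑(T.generator i) ∘ ⇑(T.generator j) = ⇑(T.generator j) ∘ ⇑(T.generator i) := by
  rw [← ContinuousMap.coe_comp, ← ContinuousMap.coe_comp, generator, generator, ← T.map_add,
    ← T.map_add, add_comm]

/-! ### Counting orbits and bounding the entropy -/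

section Entropy

variable {k n : ℕ} {A : Fin k → Matrix (Fin n) (Fin n) ℤ}
  {T : ZPlusAction k (UnitAddTorus (Fin n))}

theorem mul_comm_of_generator_eq
    (hT : ∀ i : Fin k, ⇑(T.generator i) = torusEndomorphism (A i)) (i j : Fin k) :
    A i * A j = A j * A i := by
  apply torusEndomorphism_injective
  rw [← torusEndomorphism_comp, ← torusEndomorphism_comp, ← hT, ← hT, T.generator_comp_comm]

/-- Orbits along words of length `M` are shadowed by at most `Kⁿ (∑ᵢ |det Aᵢ|) ^ M` orbits. -/
theorem exists_shadowing_finset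
    (hT : ∀ i : Fin k, ⇑(T.generator i) = torusEndomorphism (A i)) (hns : ∀ i, (A i).det ≠ 0)
    {C : ℝ} (hC0 : 0 ≤ C)
    (hC : ∀ B ∈ Submonoid.closure (Set.range A), ∀ v : Fin n → ℝ, ‖v‖ ≤ C * ‖realMatrix B *ᵥ v‖)
    (i₀ : Fin k) {K : ℕ} (hK : 0 < K) (M : ℕ) :
    ∃ E : Finset (OrbitSpace T), E.card ≤ K ^ n * (∑ i, (A i).det.natAbs) ^ M ∧
      ∀ x : OrbitSpace T, ∃ y ∈ E, ∀ m ≤ M, dist (x.seq m) (y.seq m) ≤ C * (1 / K) := by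
  classical
  -- Only the first `M` letters matter; the default letter `i₀` merely makes the word infinite.
  let ext (w : Fin M → Fin k) (m : ℕ) : Fin k := if h : m < M then w ⟨m, h⟩ else i₀
  have hdet : ∀ s : ℕ → Fin k, (wordMatrix A s M).det ≠ 0 := fun s => by
    rw [← Int.natAbs_ne_zero, natAbs_det_wordMatrix]
    exact Finset.prod_ne_zero_iff.2 fun j _ => Int.natAbs_ne_zero.2 (hns _)
  choose R hRcard hR using fun s => Matrix.exists_finset_card_eq_natAbs_det _ (hdet s)
  let pt (s : ℕ → Fin k) (a : (Fin n → ℤ) × (Fin n → Fin K)) : OrbitSpace T :=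
    OrbitSpace.ofWord hT s ((realMatrix (wordMatrix A s M))⁻¹ *ᵥ
      ((fun i => (a.1 i : ℝ)) + fun i => ((a.2 i : ℕ) : ℝ) / K))
  refine ⟨Finset.univ.biUnion fun w : Fin M → Fin k =>
    (R (ext w) ×ˢ Finset.univ).image (pt (ext w)), ?_, fun x => ?_⟩
  · refine Finset.card_biUnion_le.trans ?_
    -- Expanding the `M`-th power of the sum gives one product of determinants per word.
    rw [Fintype.sum_pow, Finset.mul_sum]
    refine Finset.sum_le_sum fun w _ => Finset.card_image_le.trans_eq ?_
    rw [Finset.card_product, hRcard, natAbs_det_wordMatrix, Finset.prod_range, mul_comm]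
    simp [ext]
  · obtain ⟨s, p, rfl⟩ := OrbitSpace.exists_eq_ofWord hT x
    let t := ext fun j => s j
    have hst : ∀ m ≤ M, wordMatrix A s m = wordMatrix A t m := fun m hm =>
      wordMatrix_congr A fun j hj => by simp [t, ext, hj.trans_le hm]
    obtain ⟨r, hr, g, h⟩ := exists_shadow A hC0 hC t M (hdet t) (hR t) hK p
    refine ⟨pt t (r, g), Finset.mem_biUnion.2 ⟨fun j => s j, Finset.mem_univ _,
      Finset.mem_image_of_mem _ (Finset.mem_product.2 ⟨hr, Finset.mem_univ _⟩)⟩, fun m hm => ?_⟩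
    simpa only [pt, OrbitSpace.ofWord, hst m hm] using h m hm

theorem coverEntropyEntourage_dist_lt_le
    (hT : ∀ i : Fin k, ⇑(T.generator i) = torusEndomorphism (A i)) (hns : ∀ i, (A i).det ≠ 0)
    (hexp : ∀ i, ∀ μ ∈ complexEigenvalues (A i), 1 < ‖μ‖) (i₀ : Fin k) {ε : ℝ} (hε : 0 < ε) :
    Dynamics.coverEntropyEntourage (OrbitSpace.shift T) Set.univ
        {p : OrbitSpace T × OrbitSpace T | dist p.1 p.2 < ε} ≤
      ENNReal.log ((∑ i, (A i).det.natAbs : ℕ) : ENNReal) := by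
  obtain ⟨C, hC0, hC⟩ :=
    exists_norm_inv_le_of_mem_closure A (mul_comm_of_generator_eq hT) hns hexp
  -- `K` and `L` are chosen so that the head and the tail of the distance series each contribute
  -- less than `ε / 2`.
  obtain ⟨K, hK⟩ := exists_nat_gt (4 * C / ε)
  have hK0 : (0 : ℝ) < K := (by positivity : (0 : ℝ) ≤ 4 * C / ε).trans_lt hK
  have hδ : 2 * (C * (1 / K)) < ε / 2 := by
    rw [div_lt_iff₀ hε] at hK
    rw [mul_one_div, mul_div_assoc', div_lt_iff₀ hK0]
    linarith
  set D := Metric.diam (Set.univ : Set (UnitAddTorus (Fin n))) with hD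
  have hD0 : 0 ≤ D := Metric.diam_nonneg
  obtain ⟨L, hL⟩ := pow_unbounded_of_one_lt (4 * D / ε) (one_lt_two (α := ℝ))
  have hL' : 2 * D / 2 ^ L < ε / 2 := by
    rw [div_lt_iff₀ hε] at hL
    rw [div_lt_iff₀ (by positivity)]
    linarith
  set S : ℕ := ∑ i, (A i).det.natAbs with hS
  -- The logarithm is the growth rate of `S ^ N`, and the constant factor `K ^ n * S ^ L` does not
  -- affect growth rates.
  rw [← ExpGrowth.expGrowthSup_pow]
  refine ExpGrowth.expGrowthSup_le_of_eventually_le (b := ((K ^ n * S ^ L : ℕ) : ENNReal))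
    (ENNReal.natCast_ne_top _) (Eventually.of_forall fun N => ?_)
  -- Times `j < N` with `L` coordinates each involve only indices below `L + N`.
  obtain ⟨E, hEcard, hE⟩ :=
    exists_shadowing_finset hT hns hC0 hC i₀ (by exact_mod_cast hK0 : 0 < K) (L + N)
  have hcover : Dynamics.IsDynCoverOf (OrbitSpace.shift T) Set.univ
      {p : OrbitSpace T × OrbitSpace T | dist p.1 p.2 < ε} N (E : Set (OrbitSpace T)) := by
    intro x _
    obtain ⟨y, hy, hxy⟩ := hE x
    refine ⟨y, hy, Dynamics.mem_dynEntourage.2 fun j hj => ?_⟩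
    refine (OrbitSpace.dist_le_of_forall_lt (δ := C * (1 / K)) (L := L) (fun m hm => ?_)
      (by positivity)).trans_lt ?_
    · rw [OrbitSpace.seq_iterate_shift, OrbitSpace.seq_iterate_shift]
      exact hxy _ (by omega)
    · linarith
  have hle : Dynamics.coverMincard (OrbitSpace.shift T) Set.univ
      {p : OrbitSpace T × OrbitSpace T | dist p.1 p.2 < ε} N ≤ ((K ^ n * S ^ L * S ^ N : ℕ) : ℕ∞) := by
    refine hcover.coverMincard_le_card.trans ?_
    rw [mul_assoc, ← pow_add]
    exact_mod_cast hEcard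
  refine (ENat.toENNReal_mono hle).trans_eq ?_
  simp

end Entropy

theorem theorem4p1 {k n : ℕ} (A : Fin k → Matrix (Fin n) (Fin n) ℤ)
    (T : ZPlusAction k (UnitAddTorus (Fin n)))
    (hT : ∀ i : Fin k, ⇑(T.generator i) = torusEndomorphism (A i))
    (hdiff : Pairwise fun i j => A i ≠ A j)
    (hns : ∀ i : Fin k, (A i).det ≠ 0)
    (hexp : ∀ i : Fin k, ∀ μ ∈ complexEigenvalues (A i), 1 < ‖μ‖) :
    friedlandEntropy T ≤
        ((Real.log (∑ i : Fin k, ((complexEigenvalues (A i)).map fun μ => ‖μ‖).prod) : ℝ) : EReal) ∧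
      Real.log (∑ i : Fin k, ((complexEigenvalues (A i)).map fun μ => ‖μ‖).prod) =
        Real.log (∑ i : Fin k, |((A i).det : ℝ)|) := by
  simp only [prod_norm_complexEigenvalues, and_true]
  rcases isEmpty_or_nonempty (Fin k) with hk | ⟨⟨i₀⟩⟩
  -- With no generators no orbit exists, and the entropy of the empty set is `⊥`.
  · have hempty : (Set.univ : Set (OrbitSpace T)) = ∅ :=
      Set.eq_empty_of_forall_notMem fun x _ => hk.elim (x.step 0).choose
    rw [friedlandEntropy, hempty, Dynamics.coverEntropy_empty]
    exact bot_le
  · rw [friedlandEntropy, Dynamics.coverEntropy_eq_iSup_basis Metric.uniformity_basis_dist]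
    refine iSup₂_le fun ε hε => (coverEntropyEntourage_dist_lt_le hT hns hexp i₀ hε).trans_eq ?_
    have hsum : ((∑ i, (A i).det.natAbs : ℕ) : ℝ) = ∑ i : Fin k, |((A i).det : ℝ)| := by
      push_cast [Nat.cast_natAbs]
      rfl
    have hpos : 0 < ∑ i : Fin k, |((A i).det : ℝ)| :=
      Finset.sum_pos (fun i _ => abs_pos.2 (by exact_mod_cast hns i)) ⟨i₀, Finset.mem_univ _⟩
    rw [← ENNReal.log_ofReal_of_pos hpos, ← hsum, ENNReal.ofReal_natCast]
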